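/- Let $k\ge 1$ be an integer. There is a function $\delta_k:\mathbb{N}\to\mathbb{R}$, depending only on $k$, with $\delta_k(m)\to 0$ as $m\to\infty$, such that the following holds. Let $\mathbb{F}_q$ be any finite field with $q$ elements, let $\psi\in\mathbb{F}_q[T]$ be any monic irreducible polynomial, of degree $n$ say, let $\gamma\in\mathbb{F}_q[T]$ be arbitrary, and let $m\ge 0$ be an integer with $$m<\frac{n}{4k^2-2k}.$$ Let $N_k(\gamma,m,\psi)$ be the number of $2k$-tuples $(x_1,\dots,x_{2k})$ of polynomials in $\mathbb{F}_q[T]$ of degree $<m$ (the zero polynomial included) such that every $x_i+\gamma$ is invertible modulo $\psi$ and $$\frac{1}{x_1+\gamma}+\dots+\frac{1}{x_k+\gamma}\equiv\frac{1}{x_{k+1}+\gamma}+\dots+\frac{1}{x_{2k}+\gamma}\pmod{\psi}.$$ Then $$N_k(\gamma,m,\psi)\le q^{(k+\delta_k(m))m}.$$ -/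

import Mathlib

open Polynomial

/-- The pairs `((x_1, …, x_k), (x_{k+1}, …, x_{2k}))` of `k`-tuples of polynomials over `F`, all of
degree `< m` (the zero polynomial included), such that every `x_i + γ` is invertible modulo `ψ` and
`∑_{i ≤ k} (x_i + γ)⁻¹ ≡ ∑_{k < i ≤ 2k} (x_i + γ)⁻¹ (mod ψ)`. The congruence is an equality in the
quotient ring `F[T] ⧸ (ψ)`; there, `Ring.inverse` of a unit is its inverse. -/
def reciprocalSolutions {F : Type*} [Field F] (k : ℕ) (γ : F[X]) (m : ℕ) (ψ : F[X]) :
    Set ((Fin k → F[X]) × (Fin k → F[X])) :=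
  {p | (∀ i, (p.1 i).degree < m ∧ (p.2 i).degree < m) ∧
    (∀ i, IsUnit (Ideal.Quotient.mk (Ideal.span {ψ}) (p.1 i + γ)) ∧
      IsUnit (Ideal.Quotient.mk (Ideal.span {ψ}) (p.2 i + γ))) ∧
    ∑ i, Ring.inverse (Ideal.Quotient.mk (Ideal.span {ψ}) (p.1 i + γ)) =
      ∑ i, Ring.inverse (Ideal.Quotient.mk (Ideal.span {ψ}) (p.2 i + γ))}

/-- Over a finite field there are finitely many solutions, so that `Set.ncard` really counts them. -/
theorem reciprocalSolutions_finite {F : Type*} [Field F] [Finite F] (k : ℕ) (γ : F[X]) (m : ℕ)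
    (ψ : F[X]) : (reciprocalSolutions k γ m ψ).Finite := by
  have hD : Finite (degreeLT F m) := Finite.of_equiv _ (degreeLTEquiv F m).symm.toEquiv
  have hS : ((degreeLT F m : Set F[X])).Finite := Set.toFinite _
  refine ((Set.Finite.pi' (ι := Fin k) (fun _ => hS)).prod
    (Set.Finite.pi' (ι := Fin k) (fun _ => hS))).subset ?_
  rintro ⟨x, y⟩ ⟨h, -⟩
  exact ⟨fun i => mem_degreeLT.2 (h i).1, fun i => mem_degreeLT.2 (h i).2⟩

/-- The number `N_k(γ, m, ψ)` of solutions. -/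
noncomputable def reciprocalCount {F : Type*} [Field F] (k : ℕ) (γ : F[X]) (m : ℕ) (ψ : F[X]) :
    ℕ :=
  (reciprocalSolutions k γ m ψ).ncard

/-! For a tuple `x` let `P_x(Z) = ∑ εᵢ ∏_{j ≠ i} (Z + xⱼ)`, with sign `1` on the first half and `-1`
on the second; a solution gives `ψ ∣ P_x(γ)`. In `Z` the degree of `P_x` is at most `2k - 1`, and
its weighted degree is at most `(2k - 1)m` when `Z` has weight `m`. So a resultant of two such
polynomials has degree at most `(2k - 1)² m < n`; it is divisible by `ψ`, hence zero. Therefore one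
fixed `f`, of positive degree `d` in `Z`, divides every `P_x` (`exists_common_primitive_factor`).
Now `ψ` drops out, and the tuples with `f ∣ P_x` are to be counted.

By Gauss's lemma, `f(-xᵢ)` divides `L ^ d` for every common multiple `L` of the differences `xⱼ -
xᵢ` (`eval_neg_dvd_pow`). Separating `j < i` from `j > i` gives two moduli whose degrees add up to
at least `v`, where `v` is about `deg f(-xᵢ) / d` (`eval_neg_dvd_sharedModulus_mul_pow`). Each
modulus is an lcm of divisors of values `f(-xⱼ)`, so by the divisor bound it has `q ^ o(m)`
possibilities once the `xⱼ` on its side are known, and it fixes the residue of `xᵢ`. Moreover the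
size of `f(-xᵢ)` confines `xᵢ` to `d` balls of size `q ^ (v + 1)`.

Hence choosing `xᵢ` after the entries on one side costs about `q ^ (v - deg D)`, with `D` the
modulus of that side. The exponents for the two sides add up to at most `m + 2`, so over all `2k`
entries one of the two orders of choice has total exponent at most `k(m + 2)`. A Markov inequality
(`card_le_of_two_sided_sum_le`) turns this into `q ^ (km + o(m))` tuples. -/

/-- The numerator `∑ εᵢ ∏_{j ≠ i} (Z + xⱼ)` of the rational function `∑ εᵢ / (Z + xᵢ)`. -/
noncomputable def reciprocalNumerator {R : Type*} [CommRing R] {n : ℕ} (ε x : Fin n → R) : R[X] :=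
  ∑ i, C (ε i) * ∏ j ∈ Finset.univ.erase i, (X + C (x j))

theorem IsPrimitive.comp_X_sub_C {R : Type*} [CommRing R] {f : R[X]} (hf : f.IsPrimitive) (a : R) :
    (f.comp (X - C a)).IsPrimitive := by
  intro r hr
  obtain ⟨g, hg⟩ := hr
  refine hf r ⟨g.comp (X + C a), ?_⟩
  have := congrArg (fun p => p.comp (X + C a)) hg
  simpa [comp_assoc] using this

/-- With `L = (xⱼ - xᵢ) lⱼ`, the factor `Z + xⱼ` becomes `(xⱼ - xᵢ)(1 + lⱼ X)`. The `i`-th summand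
lacks `Z + xᵢ` and yields the constant term `εᵢ`. Every other summand contains it as `L X`, where
`L` supplies the missing `x_k - xᵢ` and `X` kills the constant term. -/
theorem exists_reciprocalNumerator_comp_eq {R : Type*} [CommRing R] {n : ℕ} (ε x : Fin n → R) (i : Fin n) (L : R)
    (hL : ∀ j, j ≠ i → x j - x i ∣ L) :
    ∃ U : R[X], U.coeff 0 = ε i ∧ (reciprocalNumerator ε x).comp (C L * X - C (x i)) =
      C (∏ j ∈ Finset.univ.erase i, (x j - x i)) * U := by
  classical
  choose! l hl using hL
  set y : Fin n → R := fun j => x j - x i with hy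
  have hlin : ∀ j, j ≠ i → (X + C (x j)).comp (C L * X - C (x i)) = C (y j) * (1 + C (l j) * X) := by
    intro j hj
    have h1 : C L = C (y j) * C (l j) := by rw [← C_mul, ← hl j hj]
    have h2 : C (y j) = C (x j) - C (x i) := by simp [hy]
    simp only [add_comp, X_comp, C_comp]
    rw [mul_add, ← mul_assoc, ← h1, h2]; ring
  refine ⟨C (ε i) * ∏ j ∈ Finset.univ.erase i, (1 + C (l j) * X) +
    X * ∑ k ∈ Finset.univ.erase i, C (ε k) * (C (l k) *
      ∏ j ∈ (Finset.univ.erase k).erase i, (1 + C (l j) * X)), ?_, ?_⟩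
  · simp [coeff_zero_eq_eval_zero, eval_prod]
  · rw [reciprocalNumerator, sum_comp, ← Finset.add_sum_erase _ _ (Finset.mem_univ i), mul_add]
    congr 1
    · rw [mul_comp, C_comp, prod_comp, Finset.prod_congr rfl
        (fun j hj => hlin j (Finset.ne_of_mem_erase hj)), Finset.prod_mul_distrib, map_prod]
      ring
    · rw [Finset.mul_sum, Finset.mul_sum]
      refine Finset.sum_congr rfl fun k hk => ?_
      have hki : k ≠ i := Finset.ne_of_mem_erase hk
      have hik : i ∈ Finset.univ.erase k := by simp [hki.symm]
      rw [mul_comp, C_comp, prod_comp, ← Finset.mul_prod_erase _ _ hik, Finset.prod_congr rfl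
        (fun j hj => hlin j (Finset.ne_of_mem_erase hj)), Finset.prod_mul_distrib,
        ← Finset.mul_prod_erase _ _ hk, Finset.erase_right_comm, map_mul, map_prod]
      have h1 : C L = C (y k) * C (l k) := by rw [← C_mul, ← hl k hki]
      simp only [add_comp, X_comp, C_comp, sub_add_cancel]
      rw [h1]; ring

/-! ### Gauss's lemma and the divisibility of `f(-xᵢ)` -/

section Content

variable {R : Type*} [CommRing R] [IsDomain R] [NormalizedGCDMonoid R]

/-- Since `U` is primitive, the contents of `h` and `g` multiply to `c` up to a unit, and so do
their constant coefficients. Each content divides its constant coefficient, so the quotients are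
units and `h(0)` is the content of `h` up to a unit. -/
theorem C_coeff_zero_dvd_of_mul_eq_C_mul {h g U : R[X]} {c : R} (hc : c ≠ 0)
    (hU : IsUnit (U.coeff 0)) (hhg : h * g = C c * U) : C (h.coeff 0) ∣ h := by
  have hUc : IsUnit U.content := isUnit_of_dvd_unit (content_dvd_coeff 0) hU
  obtain ⟨s, hs⟩ := h.content_dvd_coeff 0
  obtain ⟨t, ht⟩ := g.content_dvd_coeff 0
  have h2 : h.coeff 0 * g.coeff 0 = c * U.coeff 0 := by
    rw [← mul_coeff_zero, hhg, mul_coeff_zero, coeff_C_zero]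
  have h3 : Associated (h.content * g.content) c := by
    have h1 := (associated_content_mul h g).symm
    rw [hhg] at h1
    exact h1.trans ((associated_content_C_mul c U).trans (associated_mul_unit_left _ _ hUc))
  have h4 : Associated (h.content * g.content) (h.content * g.content * (s * t)) := by
    have : h.content * g.content * (s * t) = c * U.coeff 0 := by
      rw [← h2, hs, ht]; ring
    rw [this]
    exact h3.trans (associated_mul_unit_right _ _ hU)
  have hne : h.content * g.content ≠ 0 := fun h0 => hc (by simpa [h0] using h3.symm)
  have hst : IsUnit (s * t) := by
    obtain ⟨u, hu⟩ := h4
    rw [← mul_left_cancel₀ hne hu]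
    exact u.isUnit
  have hsu : IsUnit s := isUnit_of_mul_isUnit_left hst
  rw [← dvd_content_iff_C_dvd, hs]
  exact (associated_mul_unit_left _ _ hsu).dvd

/-- The value `f(-xᵢ)` is the constant coefficient of `f(L X - xᵢ)`, hence divides all its
coefficients `L ^ t * F_t`, where `F = f(X - xᵢ)`. So it divides `L ^ d * F`, with `d` the degree of
`f`, and `F` is primitive. -/
theorem eval_neg_dvd_pow {n : ℕ} {ε x : Fin n → R} {f : R[X]}
    (hf : f.IsPrimitive) (hf0 : f.natDegree ≠ 0) (hfP : f ∣ reciprocalNumerator ε x) {i : Fin n}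
    (hε : IsUnit (ε i)) {L : R} (hL : ∀ j, j ≠ i → x j - x i ∣ L) :
    f.eval (-x i) ∣ L ^ f.natDegree := by
  by_cases hL0 : L = 0
  · rw [hL0, zero_pow hf0]; exact dvd_zero _
  obtain ⟨U, hU0, hU⟩ := exists_reciprocalNumerator_comp_eq ε x i L hL
  obtain ⟨g, hg⟩ := hfP
  rw [hg, mul_comp] at hU
  have hc : ∏ j ∈ Finset.univ.erase i, (x j - x i) ≠ 0 := by
    rw [Finset.prod_ne_zero_iff]
    exact fun j hj h0 => hL0 (zero_dvd_iff.1 (h0 ▸ hL j (Finset.ne_of_mem_erase hj)))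
  have hdvd := C_coeff_zero_dvd_of_mul_eq_C_mul hc (hU0 ▸ hε) hU
  set F := f.comp (X - C (x i)) with hF
  have hcomp : f.comp (C L * X - C (x i)) = F.comp (C L * X) := by
    simp [hF, comp_assoc]
  have h0 : (f.comp (C L * X - C (x i))).coeff 0 = f.eval (-x i) := by
    simp [coeff_zero_eq_eval_zero, eval_comp]
  rw [h0, hcomp] at hdvd
  have hFdeg : F.natDegree ≤ f.natDegree := by
    refine natDegree_comp_le.trans ?_
    simp
  have hall : C (f.eval (-x i)) ∣ C (L ^ f.natDegree) * F := by
    rw [C_dvd_iff_dvd_coeff]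
    intro t
    rw [coeff_C_mul]
    rcases le_or_gt t f.natDegree with ht | ht
    · have := (C_dvd_iff_dvd_coeff _ _).1 hdvd t
      rw [comp_C_mul_X_coeff] at this
      rw [← Nat.sub_add_cancel ht, pow_add, mul_assoc, mul_comm (L ^ t)]
      exact this.mul_left _
    · rw [coeff_eq_zero_of_natDegree_lt (hFdeg.trans_lt ht), mul_zero]; exact dvd_zero _
  rw [← dvd_content_iff_C_dvd] at hall
  have hdvd' := hall.trans (associated_content_C_mul _ F).dvd
  rwa [(IsPrimitive.comp_X_sub_C hf _).content_eq_one, mul_one] at hdvd'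

end Content

/-! ### Moduli from shared divisors -/

section Lcm

variable {R : Type*} [CommRing R] [IsDomain R] [NormalizedGCDMonoid R]

/-- Write `a = g a'` and `b = g b'` with `a'`, `b'` coprime. The left side splits as `t0 t1 t2` with
factors dividing `g`, `a'`, `b'`; then `t0 t1` and `t0 t2` divide the two gcds, and `t1`, `t2` are
coprime. -/
theorem gcd_lcm_dvd_lcm_gcd (k a b : R) : gcd k (lcm a b) ∣ lcm (gcd k a) (gcd k b) := by
  obtain ⟨a', b', ha, hb, hu⟩ := extract_gcd a b
  set g := gcd a b with hg
  have hcop : IsRelPrime a' b' := by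
    rw [← gcd_isUnit_iff_isRelPrime]; exact hu
  have hl : lcm a b ∣ g * (a' * b') := lcm_dvd
    (by rw [ha]; exact ⟨b', by ring⟩) (by rw [hb]; exact ⟨a', by ring⟩)
  obtain ⟨t0, s, ht0, hs, hts⟩ := exists_dvd_and_dvd_of_dvd_mul
    ((gcd_dvd_right k (lcm a b)).trans hl)
  obtain ⟨t1, t2, ht1, ht2, rfl⟩ := exists_dvd_and_dvd_of_dvd_mul hs
  have hk : t0 * (t1 * t2) ∣ k := hts ▸ gcd_dvd_left k (lcm a b)
  have h1 : t0 * t1 ∣ lcm (gcd k a) (gcd k b) := by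
    refine (dvd_gcd ((mul_dvd_mul_left t0 (dvd_mul_right t1 t2)).trans hk) ?_).trans
      (dvd_lcm_left _ _)
    rw [ha]; exact mul_dvd_mul ht0 ht1
  have h2 : t0 * t2 ∣ lcm (gcd k a) (gcd k b) := by
    refine (dvd_gcd ((mul_dvd_mul_left t0 (dvd_mul_left t2 t1)).trans hk) ?_).trans
      (dvd_lcm_right _ _)
    rw [hb]; exact mul_dvd_mul ht0 ht2
  rw [hts]
  have h12 : IsRelPrime t1 t2 := (hcop.of_dvd_left ht1).of_dvd_right ht2
  by_cases h00 : t0 = 0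
  · simpa [h00] using h1
  obtain ⟨M, hM⟩ := (dvd_mul_right t0 t1).trans h1
  rw [hM] at h1 h2 ⊢
  exact mul_dvd_mul_left _ (h12.mul_dvd ((mul_dvd_mul_iff_left h00).1 h1)
    ((mul_dvd_mul_iff_left h00).1 h2))

theorem gcd_finset_lcm_dvd {ι : Type*} (k : R) (s : Finset ι) (y : ι → R) :
    gcd k (s.lcm y) ∣ s.lcm fun i => gcd k (y i) := by
  classical
  induction s using Finset.induction_on with
  | empty => simp
  | insert a s _ ih =>
    rw [Finset.lcm_insert, Finset.lcm_insert]
    exact (gcd_lcm_dvd_lcm_gcd _ _ _).trans (lcm_dvd_lcm dvd_rfl ih)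

/-- The common divisor of `f (-y)` and `y - a`, which also divides `f (-a)`. -/
noncomputable def sharedFactor {R : Type*} [CommRing R] [NormalizedGCDMonoid R] (f : R[X])
    (y a : R) : R :=
  gcd (f.eval (-y)) (y - a)

theorem sharedFactor_dvd_sub {R : Type*} [CommRing R] [NormalizedGCDMonoid R] (f : R[X])
    (y a : R) : sharedFactor f y a ∣ y - a :=
  gcd_dvd_right _ _

theorem sharedFactor_ne_zero {R : Type*} [CommRing R] [NormalizedGCDMonoid R] {f : R[X]}
    {y : R} (hy : f.eval (-y) ≠ 0) (a : R) : sharedFactor f y a ≠ 0 :=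
  fun h => hy ((gcd_eq_zero_iff _ _).1 h).1

/-- A modulus to which `a` is known to be congruent to the elements of `s`, built only from
divisors of the values of `f` at the negatives of these elements. -/
noncomputable def sharedModulus (f : R[X]) (s : Finset R) (a : R) : R :=
  s.lcm fun y => sharedFactor f y a

/-- Modulo `y - a` the values `f(-a)` and `f(-y)` agree. This transfers the divisor from the entry
still to be chosen to a known one, whose value has few divisors. -/
theorem gcd_eval_neg_dvd {R : Type*} [CommRing R] [NormalizedGCDMonoid R] (f : R[X]) (a y : R) :
    gcd (f.eval (-a)) (y - a) ∣ gcd (f.eval (-y)) (y - a) := by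
  refine dvd_gcd ?_ (gcd_dvd_right _ _)
  have h1 : y - a ∣ f.eval (-a) - f.eval (-y) := by
    have := sub_dvd_eval_sub (-a) (-y) f
    rwa [show -a - -y = y - a by ring] at this
  have h2 := (gcd_dvd_left (f.eval (-a)) (y - a)).sub
    ((gcd_dvd_right (f.eval (-a)) (y - a)).trans h1)
  simpa using h2

theorem eval_neg_dvd_sharedModulus_mul_pow [DecidableEq R] {n : ℕ} {ε x : Fin n → R} {f : R[X]}
    (hf : f.IsPrimitive) (hf0 : f.natDegree ≠ 0) (hfP : f ∣ reciprocalNumerator ε x) (i : Fin n)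
    (hε : IsUnit (ε i)) :
    f.eval (-x i) ∣ (sharedModulus f ((Finset.Ioi i).image x) (x i) *
      sharedModulus f ((Finset.Iio i).image x) (x i)) ^ f.natDegree := by
  have key : ∀ s : Finset R, gcd (f.eval (-x i)) (s.lcm fun y => y - x i) ∣
      sharedModulus f s (x i) := fun s =>
    (gcd_finset_lcm_dvd _ _ _).trans (Finset.lcm_mono_fun fun y _ => gcd_eval_neg_dvd f (x i) y)
  set A := ((Finset.Ioi i).image x).lcm fun y => y - x i
  set B := ((Finset.Iio i).image x).lcm fun y => y - x i
  have hL : ∀ j, j ≠ i → x j - x i ∣ A * B := by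
    intro j hj
    rcases lt_or_gt_of_ne hj with h | h
    · exact (Finset.dvd_lcm (f := fun y => y - x i)
        (Finset.mem_image_of_mem x (Finset.mem_Iio.2 h))).mul_left _
    · exact (Finset.dvd_lcm (f := fun y => y - x i)
        (Finset.mem_image_of_mem x (Finset.mem_Ioi.2 h))).mul_right _
  have h1 := eval_neg_dvd_pow hf hf0 hfP hε hL
  have h2 : f.eval (-x i) ∣ gcd (f.eval (-x i)) (A * B) ^ f.natDegree :=
    (dvd_gcd dvd_rfl h1).trans gcd_pow_right_dvd_pow_gcd
  exact h2.trans (pow_dvd_pow_of_dvd ((gcd_mul_dvd_mul_gcd _ _ _).trans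
    (mul_dvd_mul (key _) (key _))) _)

end Lcm

/-! ### Weighted degree -/

section WeightedDegree

variable {F : Type*} [Field F]

/-- The homomorphism `T ↦ S`, `Z ↦ U S ^ w` from `F[T][Z]` to `F[U][S]`, which turns the degree in
which `Z` has weight `w` into the degree in `S`. -/
noncomputable def weightHom (w : ℕ) : F[X][X] →+* F[X][X] :=
  eval₂RingHom (mapRingHom C) (C X * X ^ w)

/-- The degree of a polynomial in `F[T][Z]` in which `T` has weight `1` and `Z` has weight `w`. -/
noncomputable def weightedDegree (w : ℕ) (f : F[X][X]) : ℕ := (weightHom w f).natDegree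

/-- The variable `U` records the power of `Z`, so monomials of equal weighted degree do not cancel
and the homomorphism is injective. -/
theorem coeff_coeff_weightHom (w : ℕ) (f : F[X][X]) (b t : ℕ) :
    ((weightHom w f).coeff (b + w * t)).coeff t = (f.coeff t).coeff b := by
  induction f using Polynomial.induction_on' with
  | add p q hp hq => simp [hp, hq]
  | monomial s p =>
    have h : weightHom w (monomial s p) = C (X ^ s) * p.map C * X ^ (w * s) := by
      simp [weightHom, mul_pow, ← pow_mul]; ring
    rw [h, coeff_monomial]
    split_ifs with hst
    · subst hst
      rw [coeff_mul_X_pow, coeff_C_mul, coeff_map, coeff_mul_C]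
      simp
    · rw [coeff_mul_X_pow', coeff_zero]
      split_ifs
      · rw [coeff_C_mul, coeff_map, coeff_mul_C, coeff_X_pow, if_neg (Ne.symm hst), zero_mul]
      · simp

theorem weightHom_injective (w : ℕ) : Function.Injective (weightHom (F := F) w) := by
  rw [injective_iff_map_eq_zero]
  intro f hf
  ext t b
  rw [← coeff_coeff_weightHom w, hf]
  simp

theorem natDegree_coeff_add_le_weightedDegree (w : ℕ) {f : F[X][X]} {t : ℕ} (ht : f.coeff t ≠ 0) :
    (f.coeff t).natDegree + w * t ≤ weightedDegree w f := by
  apply le_natDegree_of_ne_zero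
  intro h
  have := coeff_coeff_weightHom w f (f.coeff t).natDegree t
  rw [h, coeff_zero, coeff_natDegree, eq_comm, leadingCoeff_eq_zero] at this
  exact ht this

theorem weightedDegree_le_of_dvd (w : ℕ) {f g : F[X][X]} (hg : g ≠ 0) (hfg : f ∣ g) :
    weightedDegree w f ≤ weightedDegree w g := by
  have h0 : weightHom w g ≠ 0 := fun h => hg (weightHom_injective w (by rw [h, map_zero]))
  have h1 : weightHom w f ∣ weightHom w g := map_dvd (weightHom w) hfg
  exact natDegree_le_of_dvd h1 h0

theorem weightHom_X (w : ℕ) : weightHom (F := F) w X = C X * X ^ w := by simp [weightHom]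

theorem weightHom_C (w : ℕ) (p : F[X]) : weightHom w (C p) = p.map C := by simp [weightHom]

theorem weightedDegree_C (w : ℕ) (p : F[X]) : weightedDegree w (C p) = p.natDegree := by
  rw [weightedDegree, weightHom_C, natDegree_map]

theorem weightedDegree_X_add_C_le (w : ℕ) {p : F[X]} (hp : p.natDegree ≤ w) :
    weightedDegree w (X + C p) ≤ w := by
  rw [weightedDegree, map_add, weightHom_X, weightHom_C]
  refine natDegree_add_le_of_degree_le ((natDegree_C_mul_X_pow_le _ _)) ?_
  exact natDegree_map_le.trans hp

theorem natDegree_eval_le_weightedDegree (w : ℕ) (f : F[X][X]) {a : F[X]} (ha : a.natDegree ≤ w) :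
    (f.eval a).natDegree ≤ weightedDegree w f := by
  rw [eval_eq_sum_range]
  refine natDegree_sum_le_of_forall_le _ _ fun t _ => ?_
  by_cases h0 : f.coeff t = 0
  · simp [h0]
  refine natDegree_mul_le.trans (le_trans ?_ (natDegree_coeff_add_le_weightedDegree w h0))
  refine Nat.add_le_add_left (natDegree_pow_le.trans ?_) _
  rw [mul_comm]
  exact Nat.mul_le_mul_right _ ha

theorem natDegree_reciprocalNumerator_le {n : ℕ} (ε x : Fin n → F[X]) :
    (reciprocalNumerator ε x).natDegree ≤ n - 1 := by
  refine natDegree_sum_le_of_forall_le _ _ fun i _ => natDegree_C_mul_le _ _ |>.trans ?_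
  refine (natDegree_prod_le _ _).trans ?_
  simp

theorem weightedDegree_reciprocalNumerator_le (w : ℕ) {n : ℕ} {ε x : Fin n → F[X]}
    (hε : ∀ i, IsUnit (ε i)) (hx : ∀ i, (x i).natDegree ≤ w) :
    weightedDegree w (reciprocalNumerator ε x) ≤ (n - 1) * w := by
  rw [weightedDegree, reciprocalNumerator, map_sum]
  refine natDegree_sum_le_of_forall_le _ _ fun i _ => ?_
  rw [map_mul, map_prod]
  refine natDegree_mul_le.trans ?_
  have h1 := weightedDegree_C w (ε i)
  rw [natDegree_eq_zero_of_isUnit (hε i)] at h1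
  rw [weightedDegree] at h1
  rw [h1, zero_add]
  refine (natDegree_prod_le _ _).trans ((Finset.sum_le_card_nsmul _ _ w fun j _ =>
    weightedDegree_X_add_C_le w (hx j)).trans ?_)
  simp

end WeightedDegree

/-! ### Resultant bound and the common factor -/

section Resultant

variable {F : Type*} [Field F]

/-- In every nonzero term of the Leibniz expansion the row weights and the column weights have the
same sums, whatever the permutation. -/
theorem natDegree_det_add_le {N : ℕ} (M : Matrix (Fin N) (Fin N) F[X]) (a b : Fin N → ℕ)
    (h : ∀ i j, M i j ≠ 0 → (M i j).natDegree + a i ≤ b j) :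
    M.det.natDegree ≤ ∑ j, b j - ∑ i, a i := by
  rw [Matrix.det_apply]
  refine natDegree_sum_le_of_forall_le _ _ fun σ _ => ?_
  refine (natDegree_smul_le _ _).trans ?_
  by_cases h0 : ∏ i, M (σ i) i = 0
  · simp [h0]
  rw [← ne_eq, Finset.prod_ne_zero_iff] at h0
  refine (natDegree_prod_le _ _).trans (Nat.le_sub_of_add_le ?_)
  rw [← Equiv.sum_comp σ a, ← Finset.sum_add_distrib]
  exact Finset.sum_le_sum fun i hi => h _ _ (h0 i hi)

theorem natDegree_resultant_le {f g : F[X][X]} {w A : ℕ} (hf : f.natDegree ≤ A)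
    (hg : g.natDegree ≤ A) (hfw : weightedDegree w f ≤ A * w) (hgw : weightedDegree w g ≤ A * w) :
    (resultant f g).natDegree ≤ A * A * w := by
  rw [resultant]
  set m := f.natDegree
  set n := g.natDegree
  set b : Fin (m + n) → ℕ := Fin.addCases (fun j => A * w + w * j) (fun j => A * w + w * j)
  have key : ∀ (p : F[X][X]) (i j : ℕ), weightedDegree w p ≤ A * w → j ≤ i → p.coeff (i - j) ≠ 0 →
      (p.coeff (i - j)).natDegree + w * i ≤ A * w + w * j := by
    intro p i j hp hji hc
    have h1 := natDegree_coeff_add_le_weightedDegree w hc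
    have h2 : w * i = w * (i - j) + w * j := by rw [← mul_add, Nat.sub_add_cancel hji]
    lia
  refine (natDegree_det_add_le _ (fun i => w * i) b ?_).trans ?_
  · intro i j hij
    induction j using Fin.addCases with
    | left j =>
      simp only [sylvester, Matrix.of_apply, Fin.addCases_left, b] at hij ⊢
      split_ifs at hij ⊢ with hm
      · exact key g i j hgw hm.1 hij
      · exact absurd rfl hij
    | right j =>
      simp only [sylvester, Matrix.of_apply, Fin.addCases_right, b] at hij ⊢
      split_ifs at hij ⊢ with hm
      · exact key f i j hfw hm.1 hij
      · exact absurd rfl hij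
  · rw [Fin.sum_univ_add]
    simp only [b, Fin.addCases_left, Fin.addCases_right, Finset.sum_add_distrib, Finset.sum_const,
      Finset.card_univ, Fintype.card_fin, smul_eq_mul, ← Finset.mul_sum]
    rw [Fin.sum_univ_eq_sum_range (fun i => i) m, Fin.sum_univ_eq_sum_range (fun i => i) n,
      Fin.sum_univ_eq_sum_range (fun i => i) (m + n), Finset.sum_range_add]
    have h1 : ∑ i ∈ Finset.range n, (m + i) = n * m + ∑ i ∈ Finset.range n, i := by
      rw [Finset.sum_add_distrib, Finset.sum_const, Finset.card_range, smul_eq_mul]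
    rw [h1]
    obtain ⟨c, hc⟩ := Nat.exists_eq_add_of_le hf
    obtain ⟨d, hd⟩ := Nat.exists_eq_add_of_le hg
    rw [Nat.sub_le_iff_le_add]
    set s := ∑ i ∈ Finset.range m, i
    set t := ∑ i ∈ Finset.range n, i
    -- This is `(A - m) * (A - n) ≥ 0`.
    have h3 : (m + n) * A ≤ A * A + n * m := by
      zify at hc hd ⊢
      nlinarith [mul_nonneg (Int.natCast_nonneg c) (Int.natCast_nonneg d)]
    nlinarith [Nat.mul_le_mul_right w h3]

/-- Polynomials of small degree and weighted degree that vanish modulo `ψ` at a common point have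
a common irreducible factor which vanishes there. -/
theorem exists_common_irreducible_factor {w A : ℕ} (hA : 1 ≤ A) {ψ γ : F[X]} (hψ : Irreducible ψ)
    (hdeg : A * A * w < ψ.natDegree) {P₀ : F[X][X]} (hP₀ : P₀ ≠ 0) (hd₀ : P₀.natDegree ≤ A)
    (hw₀ : weightedDegree w P₀ ≤ A * w) (hψ₀ : ψ ∣ P₀.eval γ) :
    ∃ f : F[X][X], Irreducible f ∧ f.natDegree ≠ 0 ∧ f.natDegree ≤ A ∧
      weightedDegree w f ≤ A * w ∧ ψ ∣ f.eval γ ∧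
      ∀ P : F[X][X], P.natDegree ≤ A → weightedDegree w P ≤ A * w → ψ ∣ P.eval γ → f ∣ P := by
  obtain ⟨s, hs, ⟨u, hu⟩⟩ := WfDvdMonoid.exists_factors P₀ hP₀
  have h1 : ψ ∣ (s.map (eval γ)).prod := by
    have h2 : P₀.eval γ = (s.map (eval γ)).prod * (u : F[X][X]).eval γ := by
      rw [← hu, eval_mul, eval_multiset_prod]
    rw [h2] at hψ₀
    have h3 : IsUnit ((u : F[X][X]).eval γ) := u.isUnit.map (evalRingHom γ)
    exact (h3.dvd_mul_right).1 hψ₀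
  obtain ⟨f, hfs, hfψ⟩ := hψ.prime.exists_mem_multiset_map_dvd h1
  have hfP₀ : f ∣ P₀ := (Multiset.dvd_prod hfs).trans ⟨u, hu.symm⟩
  have hf := hs f hfs
  have hfA : f.natDegree ≤ A := (natDegree_le_of_dvd hfP₀ hP₀).trans hd₀
  have hfw : weightedDegree w f ≤ A * w := (weightedDegree_le_of_dvd w hP₀ hfP₀).trans hw₀
  -- A factor constant in `Z` would be a nonzero multiple of `ψ` of degree at most `A * w < deg ψ`.
  have hf0 : f.natDegree ≠ 0 := by
    intro h0
    obtain ⟨r, hr⟩ := natDegree_eq_zero.1 h0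
    subst hr
    rw [eval_C] at hfψ
    have hr0 : r ≠ 0 := fun h => hf.ne_zero (by rw [h, C_0])
    have h2 := natDegree_le_of_dvd hfψ hr0
    rw [weightedDegree_C] at hfw
    nlinarith [Nat.mul_le_mul_right (A * w) hA]
  refine ⟨f, hf, hf0, hfA, hfw, hfψ, fun P hPA hPw hPψ => ?_⟩
  by_contra hfP
  have hprim := hf.isPrimitive hf0
  let φ := algebraMap F[X] (FractionRing F[X])
  have hφ : Function.Injective φ := IsFractionRing.injective _ _
  have hcop : IsCoprime (f.map φ) (P.map φ) :=
    (hprim.irreducible_iff_irreducible_map_fraction_map.1 hf).coprime_iff_not_dvd.2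
      fun h => hfP (hprim.dvd_of_fraction_map_dvd_fraction_map h)
  have hres : resultant f P ≠ 0 := by
    have := resultant_ne_zero _ _ hcop
    rw [natDegree_map_eq_of_injective hφ, natDegree_map_eq_of_injective hφ,
      resultant_map_map] at this
    exact fun h => this (by rw [h, map_zero])
  obtain ⟨p, q, -, -, hpq⟩ := exists_mul_add_mul_eq_C_resultant f P le_rfl le_rfl (Or.inl hf0)
  have hdvd : ψ ∣ resultant f P := by
    have := congrArg (eval γ) hpq
    rw [eval_add, eval_mul, eval_mul, eval_C] at this
    rw [← this]
    exact (hfψ.mul_right _).add (hPψ.mul_right _)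
  have := natDegree_le_of_dvd hdvd hres
  have := natDegree_resultant_le hfA hPA hfw hPw
  lia

/-- In the situation of `exists_common_irreducible_factor`, allowing all the polynomials to vanish;
the common factor has no root `-a` with `a` of small degree and `a + γ` prime to `ψ`. -/
theorem exists_common_primitive_factor {w A : ℕ} (hA : 1 ≤ A) {ψ γ : F[X]} (hψ : Irreducible ψ)
    (hdeg : A * A * w < ψ.natDegree) :
    ∃ f : F[X][X], f.IsPrimitive ∧ f.natDegree ≠ 0 ∧ f.natDegree ≤ A ∧
      weightedDegree w f ≤ A * w ∧
      (∀ a : F[X], a.degree < w → ¬ ψ ∣ a + γ → f.eval (-a) ≠ 0) ∧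
      ∀ P : F[X][X], P.natDegree ≤ A → weightedDegree w P ≤ A * w → ψ ∣ P.eval γ → f ∣ P := by
  by_cases h : ∃ P₀ : F[X][X], P₀ ≠ 0 ∧ P₀.natDegree ≤ A ∧ weightedDegree w P₀ ≤ A * w ∧
      ψ ∣ P₀.eval γ
  · obtain ⟨P₀, h0, h1, h2, h3⟩ := h
    obtain ⟨f, hf, hf0, hfA, hfw, hfψ, hfP⟩ :=
      exists_common_irreducible_factor hA hψ hdeg h0 h1 h2 h3
    refine ⟨f, hf.isPrimitive hf0, hf0, hfA, hfw, fun a _ haψ ha => haψ ?_, hfP⟩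
    -- A root `-a` makes the irreducible `f` associated to `Z + a`, and then `ψ ∣ f(γ)` gives `ψ ∣ a
    -- + γ`.
    have hdvd : X - C (-a) ∣ f := dvd_iff_isRoot.2 ha
    have hdvd' : f ∣ X - C (-a) :=
      ((irreducible_X_sub_C (-a)).associated_of_dvd hf hdvd).symm.dvd
    have := hfψ.trans (eval_dvd (x := γ) hdvd')
    simpa [add_comm] using this
  · push Not at h
    -- Only `P = 0` has to be divided here, so any primitive `f` without small roots serves; this
    -- one has `f(-a) = T ^ w - a`.
    refine ⟨X + C (X ^ w), (monic_X_add_C _).isPrimitive, by rw [natDegree_X_add_C]; simp,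
      by rw [natDegree_X_add_C]; exact hA,
      (weightedDegree_X_add_C_le w (by simp)).trans (by nlinarith), fun a ha _ h0 => ?_,
      fun P h1 h2 h3 => ?_⟩
    · have : a = X ^ w := by
        simp only [eval_add, eval_X, eval_C] at h0
        exact (neg_add_eq_zero.1 h0)
      rw [this, degree_X_pow] at ha
      exact lt_irrefl _ ha
    · by_cases hP : P = 0
      · rw [hP]; exact dvd_zero _
      · exact absurd h3 (h P hP h1 h2)

end Resultant

section SmallDegree

/-- The polynomials of degree `< n` over a finite field. -/
noncomputable def smallPolys (F : Type*) [Field F] [Finite F] (n : ℕ) : Finset F[X] :=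
  have : Finite (degreeLT F n) := Finite.of_equiv _ (degreeLTEquiv F n).symm.toEquiv
  (Set.toFinite (degreeLT F n : Set F[X])).toFinset

variable {F : Type*} [Field F] [Finite F]

@[simp]
theorem mem_smallPolys {n : ℕ} {a : F[X]} : a ∈ smallPolys F n ↔ a.degree < n := by
  simp [smallPolys, mem_degreeLT]

theorem card_smallPolys (n : ℕ) : (smallPolys F n).card = Nat.card F ^ n := by
  have h1 : Nat.card (degreeLT F n) = Nat.card F ^ n := by
    rw [Nat.card_congr (degreeLTEquiv F n).toEquiv, Nat.card_fun]
    simp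
  rw [← h1, smallPolys]
  exact (Nat.card_eq_card_finite_toFinset _).symm

end SmallDegree

/-! ### Divisor bound uniform in the field -/

section Divisors

open UniqueFactorizationMonoid

theorem exists_add_one_le_mul_rpow {ε : ℝ} (hε : 0 < ε) :
    ∃ A : ℝ, 1 ≤ A ∧ ∀ e : ℕ, (e : ℝ) + 1 ≤ A * 2 ^ (ε * e) := by
  have hl : 0 < Real.log 2 := Real.log_pos (by norm_num)
  refine ⟨1 + 1 / (ε * Real.log 2), by have : 0 < 1 / (ε * Real.log 2) := by positivity
                                       linarith, fun e => ?_⟩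
  have h1 : 1 + e * (ε * Real.log 2) ≤ (2 : ℝ) ^ (ε * e) := by
    rw [Real.rpow_def_of_pos (by norm_num)]
    have := Real.add_one_le_exp (Real.log 2 * (ε * e))
    linarith
  have h2 : 0 < ε * Real.log 2 := by positivity
  refine le_trans ?_ (mul_le_mul_of_nonneg_left h1 (by positivity))
  have h3 : 1 / (ε * Real.log 2) * (e * (ε * Real.log 2)) = e := by field_simp
  have h4 : 0 ≤ (e : ℝ) * (ε * Real.log 2) := by positivity
  have h5 : 0 < 1 / (ε * Real.log 2) := by positivity
  nlinarith

/-- There are at most `Q ^ 2` irreducible polynomials of norm `< Q`, whatever the field. -/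
theorem card_le_sq_of_norm_lt {F : Type*} [Field F] [Finite F] {Q : ℝ} {s : Finset F[X]}
    (hs : ∀ p ∈ s, Irreducible p ∧ (Nat.card F : ℝ) ^ p.natDegree < Q) : (s.card : ℝ) ≤ Q ^ 2 := by
  rcases s.eq_empty_or_nonempty with rfl | hne
  · simpa using sq_nonneg Q
  obtain ⟨p, hp, hpmax⟩ := s.exists_max_image natDegree hne
  have hq : (1 : ℝ) ≤ Nat.card F := by exact_mod_cast Nat.one_le_iff_ne_zero.2 Nat.card_pos.ne'
  have hsub : s ⊆ smallPolys F (p.natDegree + 1) := by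
    intro r hr
    rw [mem_smallPolys]
    exact degree_le_natDegree.trans_lt (by exact_mod_cast Nat.lt_succ_of_le (hpmax r hr))
  have h1 : (s.card : ℝ) ≤ (Nat.card F : ℝ) ^ (p.natDegree + 1) := by
    have := Finset.card_le_card hsub
    rw [card_smallPolys] at this
    exact_mod_cast this
  -- As `deg p ≥ 1`, the count `q ^ (deg p + 1)` is at most the square of the norm of `p`.
  have h2 : (Nat.card F : ℝ) ≤ (Nat.card F : ℝ) ^ p.natDegree :=
    le_self_pow₀ hq (hs p hp).1.natDegree_pos.ne'
  have h3 := (hs p hp).2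
  rw [pow_succ] at h1
  nlinarith [pow_pos (zero_lt_one.trans_le hq) p.natDegree]

theorem exists_finset_gcd_mem {R : Type*} [CommRing R] [IsDomain R] [UniqueFactorizationMonoid R]
    [NormalizedGCDMonoid R] [DecidableEq R] {G : R} (hG : G ≠ 0) :
    ∃ (N : Multiset R) (S : Finset R), (∀ p ∈ N, Irreducible p) ∧ Associated N.prod G ∧
      (∀ z, gcd G z ∈ S) ∧ S.card ≤ ∏ p ∈ N.toFinset, (N.count p + 1) := by
  refine ⟨normalizedFactors G, (Finset.Iic (normalizedFactors G)).image fun s => normalize s.prod,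
    irreducible_of_normalized_factor, prod_normalizedFactors hG, fun z => ?_,
    Finset.card_image_le.trans (Multiset.card_Iic _).le⟩
  have he : gcd G z ∣ G := gcd_dvd_left G z
  have he0 : gcd G z ≠ 0 := ne_zero_of_dvd_ne_zero hG he
  refine Finset.mem_image.2 ⟨normalizedFactors (gcd G z), Finset.mem_Iic.2
    ((dvd_iff_normalizedFactors_le_normalizedFactors he0 hG).1 he), ?_⟩
  exact (normalize_eq_normalize_iff_associated.2 (prod_normalizedFactors he0)).trans
    (normalize_gcd G z)

/-- The divisor bound, uniform in the finite field. -/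
theorem exists_card_divisors_le {ε : ℝ} (hε : 0 < ε) :
    ∃ K : ℝ, 1 ≤ K ∧ ∀ (F : Type*) [Field F] [Finite F] [NormalizedGCDMonoid F[X]] (G : F[X]),
      G ≠ 0 → ∃ S : Finset F[X], (∀ z, gcd G z ∈ S) ∧
        (S.card : ℝ) ≤ K * (Nat.card F : ℝ) ^ (ε * G.natDegree) := by
  obtain ⟨A, hA, hAe⟩ := exists_add_one_le_mul_rpow hε
  -- A prime of norm at least `Q` has norm `^ ε` at least `2`, so its factor `e + 1 ≤ 2 ^ e` is
  -- absorbed. The at most `Q ^ 2` smaller primes cost a factor `A` each.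
  set Q : ℝ := 2 ^ (1 / ε) with hQ
  refine ⟨A ^ ⌈Q ^ 2⌉₊, one_le_pow₀ hA, fun F _ _ _ G hG => ?_⟩
  have : DecidableEq F[X] := Classical.decEq _
  have hq : (2 : ℝ) ≤ Nat.card F := by exact_mod_cast Finite.one_lt_card (α := F)
  set q : ℝ := (Nat.card F : ℝ) with hqdef
  have hq0 : 0 < q := by linarith
  obtain ⟨N, S, hirr, hprod, hS, hScard⟩ := exists_finset_gcd_mem hG
  refine ⟨S, hS, ?_⟩
  have hdeg : ∑ p ∈ N.toFinset, N.count p * p.natDegree = G.natDegree := by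
    have h1 := natDegree_eq_of_degree_eq (degree_eq_degree_of_associated hprod)
    rw [← h1, Finset.prod_multiset_count, natDegree_prod]
    · simp [natDegree_pow]
    · intro p hp
      exact pow_ne_zero _ (hirr p (Multiset.mem_toFinset.1 hp)).ne_zero
  have hfac : ∀ p ∈ N.toFinset, ((N.count p + 1 : ℕ) : ℝ) ≤
      q ^ (ε * (N.count p * p.natDegree : ℕ)) * if q ^ p.natDegree < Q then A else 1 := by
    intro p hp
    have hp1 : 1 ≤ p.natDegree :=
      (hirr p (Multiset.mem_toFinset.1 hp)).natDegree_pos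
    set e := N.count p
    push_cast
    split_ifs with hpQ
    · rw [mul_comm]
      refine (hAe e).trans (mul_le_mul_of_nonneg_left ?_ (by linarith))
      refine (Real.rpow_le_rpow (by norm_num) hq (by positivity)).trans ?_
      refine Real.rpow_le_rpow_of_exponent_le (by linarith) ?_
      refine mul_le_mul_of_nonneg_left ?_ hε.le
      exact le_mul_of_one_le_right (by positivity) (by exact_mod_cast hp1)
    · rw [mul_one]
      have h1 : q ^ (ε * (e * p.natDegree : ℝ)) = ((q ^ p.natDegree) ^ ε) ^ e := by
        rw [← Real.rpow_natCast q, ← Real.rpow_mul hq0.le, ← Real.rpow_natCast,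
          ← Real.rpow_mul hq0.le]
        ring_nf
      have h2 : (2 : ℝ) ≤ (q ^ p.natDegree) ^ ε := by
        refine le_trans (le_of_eq ?_) (Real.rpow_le_rpow (by positivity) (not_lt.1 hpQ) hε.le)
        rw [hQ, ← Real.rpow_mul (by norm_num), one_div_mul_cancel hε.ne', Real.rpow_one]
      rw [h1]
      refine le_trans ?_ (pow_le_pow_left₀ (by norm_num) h2 e)
      have := one_add_mul_le_pow (show (-2 : ℝ) ≤ 1 by norm_num) e
      norm_num at this
      linarith
  calc (S.card : ℝ)
      ≤ ∏ p ∈ N.toFinset, ((N.count p + 1 : ℕ) : ℝ) := by exact_mod_cast hScard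
    _ ≤ ∏ p ∈ N.toFinset, (q ^ (ε * (N.count p * p.natDegree : ℕ)) *
          if q ^ p.natDegree < Q then A else 1) :=
        Finset.prod_le_prod (fun _ _ => by positivity) hfac
    _ = q ^ (ε * G.natDegree) * A ^ (N.toFinset.filter fun p => q ^ p.natDegree < Q).card := by
        rw [Finset.prod_mul_distrib, ← Real.rpow_sum_of_pos hq0, ← Finset.mul_sum, ← hdeg,
          Nat.cast_sum, Finset.prod_ite, Finset.prod_const, Finset.prod_const_one, mul_one]
    _ ≤ A ^ ⌈Q ^ 2⌉₊ * q ^ (ε * G.natDegree) := by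
        rw [mul_comm]
        refine mul_le_mul_of_nonneg_right (pow_le_pow_right₀ hA ?_) (by positivity)
        have h1 := card_le_sq_of_norm_lt (s := N.toFinset.filter fun p => q ^ p.natDegree < Q)
          (Q := Q) fun p hp => ⟨hirr p
            (Multiset.mem_toFinset.1 (Finset.mem_filter.1 hp).1), (Finset.mem_filter.1 hp).2⟩
        exact_mod_cast h1.trans (Nat.le_ceil _)

end Divisors

/-! ### Elements at which `f` is small -/

section Interpolation

variable {F : Type*} [Field F]

/-- A polynomial of degree `d` in `Z` is not small at more than `d` points that are far apart. -/
theorem card_le_of_degree_eval_lt {B : ℕ} (d : ℕ) {f : F[X][X]} (hf0 : f ≠ 0)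
    (hf : f.natDegree = d) {t : Finset F[X]}
    (hsep : ∀ a ∈ t, ∀ b ∈ t, a ≠ b → (B : WithBot ℕ) ≤ (a - b).degree)
    (hsmall : ∀ a ∈ t, (f.eval a).degree < (d * B : ℕ)) : t.card ≤ d := by
  classical
  induction d generalizing f t with
  | zero =>
    rw [Nat.le_zero, Finset.card_eq_zero, Finset.eq_empty_iff_forall_notMem]
    intro a ha
    obtain ⟨r, rfl⟩ := natDegree_eq_zero.1 hf
    have := hsmall a ha
    rw [eval_C, zero_mul, Nat.cast_zero, ← not_le, zero_le_degree_iff] at this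
    exact this fun h => hf0 (by rw [h, C_0])
  | succ d ih =>
    rcases t.eq_empty_or_nonempty with rfl | ⟨a, ha⟩
    · simp
    have hg : (f /ₘ (X - C a)).natDegree = d := by
      rw [natDegree_divByMonic _ (monic_X_sub_C a), hf, natDegree_X_sub_C, Nat.add_sub_cancel]
    have hfe : C (f.eval a) + (X - C a) * (f /ₘ (X - C a)) = f := by
      rw [← modByMonic_X_sub_C_eq_C_eval]; exact modByMonic_add_div _ _
    have hg0 : f /ₘ (X - C a) ≠ 0 := by
      intro h
      rw [h, mul_zero, add_zero] at hfe
      rw [← hfe, natDegree_C] at hf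
      lia
    -- At `b ≠ a` the quotient by `X - a` is `(f(b) - f(a)) / (b - a)`, with denominator of degree
    -- at least `B`, so its degree there is below `d * B`.
    have h1 : (t.erase a).card ≤ d := by
      refine ih hg0 hg (fun b hb c hc => hsep b (Finset.mem_of_mem_erase hb) c
        (Finset.mem_of_mem_erase hc)) fun b hb => ?_
      have hbt := Finset.mem_of_mem_erase hb
      have h2 : (b - a) * (f /ₘ (X - C a)).eval b = f.eval b - f.eval a := by
        conv_rhs => rw [← hfe]
        simp
      have h3 : ((b - a) * (f /ₘ (X - C a)).eval b).degree < ((d + 1) * B : ℕ) := by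
        rw [h2]
        exact (degree_sub_le _ _).trans_lt (max_lt (hsmall b hbt) (hsmall a ha))
      by_contra hlt
      rw [degree_mul] at h3
      refine absurd h3 (not_lt.2 ?_)
      rw [add_mul, one_mul, add_comm, Nat.cast_add]
      exact add_le_add (hsep b hbt a ha (Finset.ne_of_mem_erase hb)) (not_lt.1 hlt)
    rw [Finset.card_erase_of_mem ha] at h1
    lia

theorem divByMonic_X_pow_eq_iff {B : ℕ} {a b : F[X]} :
    a /ₘ X ^ B = b /ₘ X ^ B ↔ (a - b).degree < B := by
  have hX : (X ^ B : F[X]).Monic := monic_X_pow B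
  have hr : ∀ c : F[X], (c %ₘ X ^ B).degree < B := fun c =>
    (degree_modByMonic_lt c hX).trans_eq (degree_X_pow B)
  constructor
  · intro h
    have h1 : a - b = a %ₘ X ^ B - b %ₘ X ^ B := by
      conv_lhs => rw [← modByMonic_add_div a (X ^ B), ← modByMonic_add_div b (X ^ B), h]
      ring
    rw [h1]
    exact (degree_sub_le _ _).trans_lt (max_lt (hr a) (hr b))
  · intro h
    refine (div_modByMonic_unique (b /ₘ X ^ B) (b %ₘ X ^ B + (a - b)) hX ⟨?_, ?_⟩).1
    · linear_combination modByMonic_add_div b (X ^ B)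
    · rw [degree_X_pow]
      exact (degree_add_le _ _).trans_lt (max_lt (hr b) h)

end Interpolation

section ResidueClass

variable {F : Type*} [Field F] [Finite F]

theorem card_le_pow_of_dvd_sub {B : ℕ} {D : F[X]} (hD : D ≠ 0) {t : Finset F[X]}
    (hdvd : ∀ a ∈ t, ∀ b ∈ t, D ∣ a - b) (hsmall : ∀ a ∈ t, ∀ b ∈ t, (a - b).degree < B) :
    t.card ≤ Nat.card F ^ (B - D.natDegree) := by
  rcases t.eq_empty_or_nonempty with rfl | ⟨b, hb⟩
  · simp
  rw [← card_smallPolys]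
  have hmul : ∀ a ∈ t, D * ((a - b) / D) = a - b := fun a ha =>
    EuclideanDomain.mul_div_cancel' hD (hdvd a ha b hb)
  refine Finset.card_le_card_of_injOn (fun a => (a - b) / D) (fun a ha => ?_) fun a ha c hc h => ?_
  · rw [Finset.mem_coe, mem_smallPolys]
    have h1 := hsmall a ha b hb
    rw [← hmul a ha, degree_mul, degree_eq_natDegree hD] at h1
    by_cases h0 : (a - b) / D = 0
    · simp [h0]
    rw [degree_eq_natDegree h0] at h1 ⊢
    norm_cast at h1 ⊢
    lia
  · have h1 := hmul a ha
    rw [show (a - b) / D = (c - b) / D from h, hmul c hc] at h1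
    exact (sub_left_injective h1).symm

/-- Cut `t` into balls by the quotient modulo `X ^ B`. Each ball holds at most `q ^ (B - deg D)`
elements congruent modulo `D`; representatives of distinct balls are far apart, so there are at most
`d` balls. -/
theorem card_le_mul_pow_of_degree_eval_neg_lt {B d : ℕ} {f : F[X][X]} (hf : f.natDegree = d)
    (hd : d ≠ 0) {D : F[X]} (hD : D ≠ 0) {t : Finset F[X]} (hdvd : ∀ a ∈ t, ∀ b ∈ t, D ∣ a - b)
    (hsmall : ∀ a ∈ t, (f.eval (-a)).degree < (d * B : ℕ)) :
    t.card ≤ d * Nat.card F ^ (B - D.natDegree) := by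
  classical
  have h1 : t.card ≤ Nat.card F ^ (B - D.natDegree) * (t.image fun a => a /ₘ X ^ B).card := by
    refine Finset.card_le_mul_card_image _ _ fun c _ => ?_
    refine card_le_pow_of_dvd_sub hD (fun a ha b hb => hdvd a (Finset.mem_filter.1 ha).1 b
      (Finset.mem_filter.1 hb).1) fun a ha b hb => divByMonic_X_pow_eq_iff.1 ?_
    rw [(Finset.mem_filter.1 ha).2, (Finset.mem_filter.1 hb).2]
  refine h1.trans ?_
  rw [mul_comm]
  refine Nat.mul_le_mul_right _ ?_
  obtain ⟨u, hut, hinj, hu⟩ := Finset.exists_subset_injOn_image_eq_of_surjOn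
    (t : Set F[X]) (t.image fun a => a /ₘ X ^ B) (f := fun a => a /ₘ X ^ B)
    (by rw [Finset.coe_image]; exact Set.surjOn_image _ _)
  rw [← hu, Finset.card_image_of_injOn hinj]
  have hcomp : (f.comp (-X)).natDegree = d := by
    rw [natDegree_comp, natDegree_neg, natDegree_X, hf, mul_one]
  refine card_le_of_degree_eval_lt (B := B) d (f := f.comp (-X)) ?_ hcomp ?_ ?_
  · intro h
    rw [h, natDegree_zero] at hcomp
    exact hd hcomp.symm
  · intro a ha b hb hab
    by_contra hlt
    exact hab (hinj ha hb (divByMonic_X_pow_eq_iff.2 (not_le.1 hlt)))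
  · intro a ha
    have := hsmall a (hut ha)
    simpa [eval_comp] using this

end ResidueClass

/-! ### Weighted count of one entry given its history -/

section WeightedCount

variable {F : Type*} [Field F] [Finite F] [NormalizedGCDMonoid F[X]]

/-- The size of `f (-a)`, per root of `f` and capped at `m`. -/
noncomputable def valueSize (f : F[X][X]) (m : ℕ) (a : F[X]) : ℕ :=
  min m ((f.eval (-a)).natDegree / f.natDegree)

/-- Up to a bounded factor, `q ^ freedom` elements with the same `valueSize` as `a` agree with `a`
modulo `sharedModulus f s a`. -/
noncomputable def freedom (f : F[X][X]) (m : ℕ) (s : Finset F[X]) (a : F[X]) : ℕ :=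
  valueSize f m a + 1 - (sharedModulus f s a).natDegree

/-- Group the `a` by `valueSize` and by all shared factors with `s`: at most `(m + 1) * τ ^ n`
groups. On a group `freedom` is constant, and the group has at most `deg f * q ^ freedom` elements.
-/
theorem sum_inv_pow_freedom_le {f : F[X][X]} (hf : f.natDegree ≠ 0) {m n : ℕ} {s A : Finset F[X]}
    (hs : ∀ y ∈ s, f.eval (-y) ≠ 0) (hsn : s.card ≤ n) (hA : ∀ a ∈ A, a.degree < m) {τ : ℝ}
    (hτ : 1 ≤ τ) (hdiv : ∀ y ∈ s, ∃ S : Finset F[X],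
      (∀ z, gcd (f.eval (-y)) z ∈ S) ∧ (S.card : ℝ) ≤ τ) :
    ∑ a ∈ A, ((Nat.card F : ℝ) ^ freedom f m s a)⁻¹ ≤ (m + 1) * τ ^ n * f.natDegree := by
  classical
  have hq0 : (0 : ℝ) < Nat.card F := by exact_mod_cast Nat.card_pos
  choose! S hS hScard using hdiv
  let key : F[X] → ℕ × ((y : F[X]) → y ∈ s → F[X]) := fun a =>
    (valueSize f m a, fun y _ => sharedFactor f y a)
  have hkey : ∀ a ∈ A, key a ∈ Finset.range (m + 1) ×ˢ s.pi S := by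
    intro a _
    refine Finset.mem_product.2 ⟨Finset.mem_range.2 (Nat.lt_succ_of_le (min_le_left _ _)),
      Finset.mem_pi.2 fun y hy => hS y hy _⟩
  rw [← Finset.sum_fiberwise_of_maps_to hkey]
  have hfib : ∀ κ ∈ Finset.range (m + 1) ×ˢ s.pi S,
      ∑ a ∈ A with key a = κ, ((Nat.card F : ℝ) ^ freedom f m s a)⁻¹ ≤ f.natDegree := by
    intro κ _
    rcases (A.filter fun a => key a = κ).eq_empty_or_nonempty with h | ⟨b, hb⟩
    · rw [h]; simp
    have hkb : ∀ a ∈ A.filter (fun a => key a = κ), key a = key b := fun a ha => by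
      rw [(Finset.mem_filter.1 ha).2, (Finset.mem_filter.1 hb).2]
    have hv : ∀ a ∈ A.filter (fun a => key a = κ), valueSize f m a = valueSize f m b :=
      fun a ha => congrArg Prod.fst (hkb a ha)
    have hg : ∀ a ∈ A.filter (fun a => key a = κ), ∀ y ∈ s,
        sharedFactor f y a = sharedFactor f y b := fun a ha y hy =>
      congrFun (congrFun (congrArg Prod.snd (hkb a ha)) y) hy
    have hmod : ∀ a ∈ A.filter (fun a => key a = κ), sharedModulus f s a = sharedModulus f s b :=
      fun a ha => Finset.lcm_congr rfl (hg a ha)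
    set D := sharedModulus f s b with hD
    have hD0 : D ≠ 0 := by
      rw [hD, sharedModulus, Finset.lcm_ne_zero_iff]
      intro y hy h0
      exact sharedFactor_ne_zero (hs y hy) b h0
    have hdvd : ∀ a ∈ A.filter (fun a => key a = κ), ∀ c ∈ A.filter (fun a => key a = κ),
        D ∣ a - c := by
      intro a ha c hc
      refine Finset.lcm_dvd fun y hy => ?_
      have h1 : sharedFactor f y b ∣ y - a := hg a ha y hy ▸ sharedFactor_dvd_sub f y _
      have h2 : sharedFactor f y b ∣ y - c := hg c hc y hy ▸ sharedFactor_dvd_sub f y _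
      simpa using h2.sub h1
    have hcard : (A.filter fun a => key a = κ).card ≤
        f.natDegree * Nat.card F ^ (valueSize f m b + 1 - D.natDegree) := by
      -- In the capped case `deg a < m` already puts everything in one ball; otherwise `valueSize`
      -- truly bounds `f(-a)`.
      by_cases hvm : valueSize f m b = m
      · have h1 := card_le_pow_of_dvd_sub (B := m) hD0 hdvd fun a ha c hc =>
          (degree_sub_le _ _).trans_lt (max_lt (hA a (Finset.mem_filter.1 ha).1)
            (hA c (Finset.mem_filter.1 hc).1))
        refine (h1.trans (Nat.pow_le_pow_right Nat.card_pos (by lia))).trans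
          (Nat.le_mul_of_pos_left _ (Nat.pos_of_ne_zero hf))
      · refine card_le_mul_pow_of_degree_eval_neg_lt rfl hf hD0 hdvd fun a ha => ?_
        refine degree_le_natDegree.trans_lt (Nat.cast_lt.2 ?_)
        have h1 := hv a ha
        have h2 : (f.eval (-a)).natDegree / f.natDegree = valueSize f m b := by
          rw [valueSize] at h1
          rcases min_choice m ((f.eval (-a)).natDegree / f.natDegree) with h | h
          · exact absurd (h ▸ h1).symm hvm
          · exact h ▸ h1
        rw [← h2, mul_comm]
        exact Nat.lt_mul_of_div_lt (Nat.lt_succ_self _) (Nat.pos_of_ne_zero hf)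
    calc ∑ a ∈ A with key a = κ, ((Nat.card F : ℝ) ^ freedom f m s a)⁻¹
        = ∑ a ∈ A with key a = κ, ((Nat.card F : ℝ) ^ (valueSize f m b + 1 - D.natDegree))⁻¹ :=
          Finset.sum_congr rfl fun a ha => by rw [freedom, hv a ha, hmod a ha]
      _ ≤ f.natDegree := by
          rw [Finset.sum_const, nsmul_eq_mul, ← div_eq_mul_inv, div_le_iff₀ (by positivity)]
          exact_mod_cast hcard
  refine (Finset.sum_le_sum hfib).trans ?_
  rw [Finset.sum_const, nsmul_eq_mul, Finset.card_product, Finset.card_range, Finset.card_pi]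
  push_cast
  have h1 : ∏ y ∈ s, ((S y).card : ℝ) ≤ τ ^ n :=
    (Finset.prod_le_prod (fun _ _ => by positivity) hScard).trans
      ((Finset.prod_const τ).trans_le (pow_le_pow_right₀ hτ hsn))
  gcongr

end WeightedCount

/-! ### Counting tuples by histories -/

section Markov

/-- The history of an entry is the set of later entries. That of the first entry is the whole
remaining tuple, so summing over the first entry costs a factor `K` and leaves the shorter sum. -/
theorem sum_prod_history_le {α : Type*} [Fintype α] [DecidableEq α] (w : Finset α → α → ℝ)
    (hw : ∀ s a, 0 ≤ w s a) {K : ℝ} {N : ℕ}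
    (hK : ∀ s : Finset α, s.card ≤ N → ∑ a, w s a ≤ K) (n : ℕ) (hn : n ≤ N) :
    ∑ x : Fin n → α, ∏ j, w ((Finset.Ioi j).image x) (x j) ≤ K ^ n := by
  have hK0 : 0 ≤ K := (Finset.sum_nonneg fun a _ => hw ∅ a).trans (hK ∅ (by simp))
  induction n with
  | zero => simp
  | succ n ih =>
    rw [← (Fin.consEquiv fun _ => α).sum_comp, Fintype.sum_prod_type_right]
    have h1 : ∀ (x : Fin n → α) (a : α),
        ∏ j, w ((Finset.Ioi j).image (Fin.consEquiv (fun _ => α) (a, x)))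
          (Fin.consEquiv (fun _ => α) (a, x) j) =
        w (Finset.univ.image x) a * ∏ j, w ((Finset.Ioi j).image x) (x j) := by
      intro x a
      have h2 : ∀ t : Finset (Fin n), (t.map (Fin.succEmb n)).image
          (Fin.consEquiv (fun _ => α) (a, x)) = t.image x := by
        intro t
        rw [Finset.map_eq_image, Finset.image_image]
        rfl
      rw [Fin.prod_univ_succ]
      simp only [Fin.Ioi_zero_eq_map, Fin.Ioi_succ, h2, Fin.consEquiv_apply, Fin.cons_zero,
        Fin.cons_succ]
    simp only [h1, ← Finset.sum_mul]
    calc ∑ x : Fin n → α, (∑ a, w (Finset.univ.image x) a) * ∏ j, w ((Finset.Ioi j).image x) (x j)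
        ≤ ∑ x : Fin n → α, K * ∏ j, w ((Finset.Ioi j).image x) (x j) :=
          Finset.sum_le_sum fun x _ => mul_le_mul_of_nonneg_right
            (hK _ (Finset.card_image_le.trans (by simp; lia)))
            (Finset.prod_nonneg fun _ _ => hw _ _)
      _ ≤ K ^ (n + 1) := by
          rw [← Finset.mul_sum, pow_succ']
          exact mul_le_mul_of_nonneg_left (ih (by lia)) hK0

/-- Markov's inequality: each counted tuple contributes at least `q ^ (-M)` to a sum bounded by `K ^
n`. -/
theorem card_filter_sum_history_le {α : Type*} [Fintype α] [DecidableEq α] {q : ℝ} (hq : 1 ≤ q)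
    (e : Finset α → α → ℕ) {K : ℝ} {n : ℕ}
    (hK : ∀ s : Finset α, s.card ≤ n → ∑ a, (q ^ e s a)⁻¹ ≤ K) (M : ℕ) :
    (({x : Fin n → α | ∑ j, e ((Finset.Ioi j).image x) (x j) ≤ M} : Finset _).card : ℝ) ≤
      q ^ M * K ^ n := by
  have hq0 : 0 < q := by linarith
  have h1 := sum_prod_history_le (fun s a => (q ^ e s a)⁻¹) (fun _ _ => by positivity) hK n le_rfl
  rw [← div_le_iff₀' (by positivity), div_eq_mul_inv, ← nsmul_eq_mul, ← Finset.sum_const]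
  refine le_trans ?_ h1
  refine (Finset.sum_le_sum fun x hx => ?_).trans
    (Finset.sum_le_univ_sum_of_nonneg fun x => Finset.prod_nonneg fun _ _ => by positivity)
  rw [Finset.prod_inv_distrib, Finset.prod_pow_eq_pow_sum]
  exact inv_anti₀ (by positivity) (pow_le_pow_right₀ hq (Finset.mem_filter.1 hx).2)

theorem image_rev_Ioi_rev {n : ℕ} {α : Type*} [DecidableEq α] (x : Fin n → α) (j : Fin n) :
    (Finset.Ioi j.rev).image (fun i => x i.rev) = (Finset.Iio j).image x := by
  ext a
  simp only [Finset.mem_image, Finset.mem_Ioi, Finset.mem_Iio]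
  constructor
  · rintro ⟨i, hi, rfl⟩
    exact ⟨i.rev, Fin.rev_lt_iff.1 hi, rfl⟩
  · rintro ⟨i, hi, rfl⟩
    exact ⟨i.rev, Fin.rev_lt_rev.2 hi, by rw [Fin.rev_rev]⟩

/-- If the exponents of a tuple for the histories to the right and to the left have a bounded sum,
then one of the two has at most half of it. -/
theorem card_le_of_two_sided_sum_le {α : Type*} [Fintype α] [DecidableEq α] {q : ℝ} (hq : 1 ≤ q)
    (e : Finset α → α → ℕ) {K : ℝ} {n M : ℕ}
    (hK : ∀ s : Finset α, s.card ≤ n → ∑ a, (q ^ e s a)⁻¹ ≤ K) (s : Finset (Fin n → α))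
    (hs : ∀ x ∈ s, ∑ j, (e ((Finset.Ioi j).image x) (x j) + e ((Finset.Iio j).image x) (x j)) ≤
      2 * M) : (s.card : ℝ) ≤ 2 * q ^ M * K ^ n := by
  set T : Finset (Fin n → α) := {x | ∑ j, e ((Finset.Ioi j).image x) (x j) ≤ M} with hT
  have hTc : (T.card : ℝ) ≤ q ^ M * K ^ n := card_filter_sum_history_le hq e hK M
  -- Reversing a tuple exchanges left and right histories.
  have hsub : s ⊆ T ∪ T.image fun x j => x j.rev := by
    intro x hx
    have h1 := hs x hx
    rw [Finset.sum_add_distrib] at h1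
    rw [Finset.mem_union]
    by_cases h2 : ∑ j, e ((Finset.Ioi j).image x) (x j) ≤ M
    · exact Or.inl (Finset.mem_filter.2 ⟨Finset.mem_univ _, h2⟩)
    · refine Or.inr (Finset.mem_image.2 ⟨fun j => x j.rev, Finset.mem_filter.2
        ⟨Finset.mem_univ _, ?_⟩, by simp⟩)
      rw [← Equiv.sum_comp Fin.revPerm]
      simp only [Fin.revPerm_apply, image_rev_Ioi_rev, Fin.rev_rev]
      lia
  have h3 : s.card ≤ T.card + T.card :=
    (Finset.card_le_card hsub).trans ((Finset.card_union_le _ _).trans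
      (Nat.add_le_add_left Finset.card_image_le _))
  have h4 : (s.card : ℝ) ≤ T.card + T.card := by exact_mod_cast h3
  linarith

end Markov

theorem natDegree_le_of_dvd_mul_pow {F : Type*} [Field F] {a b c : F[X]} {d : ℕ} (hb : b ≠ 0) (hc : c ≠ 0)
    (h : a ∣ (b * c) ^ d) : a.natDegree / d ≤ b.natDegree + c.natDegree := by
  have h1 := natDegree_le_of_dvd h (pow_ne_zero _ (mul_ne_zero hb hc))
  rw [natDegree_pow, natDegree_mul hb hc] at h1
  exact Nat.div_le_of_le_mul h1

/-! ### Tuples whose numerator is a multiple of `f` -/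

section Count

variable {F : Type*} [Field F] [Finite F] [NormalizedGCDMonoid F[X]]

theorem card_reciprocalNumerator_multiples_le [DecidableEq F[X]] {f : F[X][X]} (hf : f.IsPrimitive)
    (hf0 : f.natDegree ≠ 0) {m k : ℕ} {A : Finset F[X]} (hA : ∀ a ∈ A, a.degree < m)
    (hAf : ∀ a ∈ A, f.eval (-a) ≠ 0) {τ : ℝ} (hτ : 1 ≤ τ)
    (hdiv : ∀ y ∈ A, ∃ S : Finset F[X], (∀ z, gcd (f.eval (-y)) z ∈ S) ∧ (S.card : ℝ) ≤ τ)
    {ε : Fin (k + k) → F[X]} (hε : ∀ i, IsUnit (ε i)) (s : Finset (Fin (k + k) → A))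
    (hs : ∀ x ∈ s, f ∣ reciprocalNumerator ε fun i => (x i : F[X])) :
    (s.card : ℝ) ≤ 2 * (Nat.card F : ℝ) ^ (k * (m + 2)) *
      ((m + 1) * τ ^ (k + k) * f.natDegree) ^ (k + k) := by
  have hq : (1 : ℝ) ≤ Nat.card F := by exact_mod_cast Nat.one_le_iff_ne_zero.2 Nat.card_pos.ne'
  have himage : ∀ t : Finset A, ∀ y ∈ t.image (Subtype.val), y ∈ A := by
    intro t y hy
    obtain ⟨z, -, rfl⟩ := Finset.mem_image.1 hy
    exact z.2
  refine card_le_of_two_sided_sum_le hq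
    (fun t a => freedom f m (t.image Subtype.val) (a : F[X])) (fun t ht => ?_) s fun x hx => ?_
  · rw [Finset.sum_coe_sort A fun a => ((Nat.card F : ℝ) ^ freedom f m (t.image Subtype.val) a)⁻¹]
    exact sum_inv_pow_freedom_le hf0 (fun y hy => hAf y (himage t y hy))
      (Finset.card_image_le.trans ht) hA hτ fun y hy => hdiv y (himage t y hy)
  · have hmod : ∀ (t : Finset A) (a : F[X]), sharedModulus f (t.image Subtype.val) a ≠ 0 := by
      intro t a
      rw [sharedModulus, Finset.lcm_ne_zero_iff]
      exact fun y hy => sharedFactor_ne_zero (hAf y (himage t y hy)) a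
    -- With `v` the `valueSize`, the two moduli have degrees of sum at least `v`. Two positive
    -- freedoms thus add up to at most `2 * (v + 1) - v ≤ m + 2`; if one is truncated to `0`, the
    -- other is at most `v + 1`.
    have hj : ∀ j : Fin (k + k),
        freedom f m (((Finset.Ioi j).image x).image Subtype.val) (x j : F[X]) +
          freedom f m (((Finset.Iio j).image x).image Subtype.val) (x j : F[X]) ≤ m + 2 := by
      intro j
      have h1 := eval_neg_dvd_sharedModulus_mul_pow hf hf0 (hs x hx) j (hε j)
      have h2 := natDegree_le_of_dvd_mul_pow (hmod ((Finset.Ioi j).image x) (x j))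
        (hmod ((Finset.Iio j).image x) (x j))
        (d := f.natDegree) (a := f.eval (-(x j : F[X])))
        (by rw [Finset.image_image, Finset.image_image]; exact h1)
      have h3 : valueSize f m (x j : F[X]) ≤ m := min_le_left _ _
      have h4 : valueSize f m (x j : F[X]) ≤ _ := (min_le_right _ _).trans h2
      simp only [freedom]
      lia
    refine (Finset.sum_le_sum fun j _ => hj j).trans (le_of_eq ?_)
    simp
    ring

end Count

/-! ### From solutions of the congruence to numerators -/

section Solutions

theorem sum_mul_prod_erase_eq_zero {R : Type*} [CommRing R] {n : ℕ} {ε u : Fin n → R}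
    (hu : ∀ i, IsUnit (u i)) (h : ∑ i, ε i * Ring.inverse (u i) = 0) :
    ∑ i, ε i * ∏ j ∈ Finset.univ.erase i, u j = 0 := by
  have h1 : ∀ i, ε i * ∏ j ∈ Finset.univ.erase i, u j = ε i * Ring.inverse (u i) * ∏ j, u j := by
    intro i
    rw [← Finset.mul_prod_erase _ _ (Finset.mem_univ i), mul_assoc, ← mul_assoc (Ring.inverse _),
      Ring.inverse_mul_cancel _ (hu i), one_mul]
  simp only [h1, ← Finset.sum_mul, h, zero_mul]

/-- The sign `1` on the first `k` indices and `-1` on the last `k`. -/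
noncomputable def pairSign (R : Type*) [CommRing R] (k : ℕ) : Fin (k + k) → R :=
  Fin.append (fun _ => 1) fun _ => -1

theorem isUnit_pairSign (R : Type*) [CommRing R] (k : ℕ) (i : Fin (k + k)) :
    IsUnit (pairSign R k i) := by
  rw [pairSign]
  induction i using Fin.addCases with
  | left i => rw [Fin.append_left]; exact isUnit_one
  | right i => rw [Fin.append_right]; exact isUnit_one.neg

variable {F : Type*} [Field F] {k m : ℕ} {γ ψ : F[X]} {p : (Fin k → F[X]) × (Fin k → F[X])}

theorem degree_append_lt (hp : p ∈ reciprocalSolutions k γ m ψ) (i : Fin (k + k)) :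
    (Fin.append p.1 p.2 i).degree < m := by
  induction i using Fin.addCases with
  | left i => rw [Fin.append_left]; exact (hp.1 i).1
  | right i => rw [Fin.append_right]; exact (hp.1 i).2

theorem isUnit_mk_append_add (hp : p ∈ reciprocalSolutions k γ m ψ) (i : Fin (k + k)) :
    IsUnit (Ideal.Quotient.mk (Ideal.span {ψ}) (Fin.append p.1 p.2 i + γ)) := by
  induction i using Fin.addCases with
  | left i => rw [Fin.append_left]; exact (hp.2.1 i).1
  | right i => rw [Fin.append_right]; exact (hp.2.1 i).2

theorem not_dvd_append_add (hψ : Irreducible ψ) (hp : p ∈ reciprocalSolutions k γ m ψ)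
    (i : Fin (k + k)) : ¬ ψ ∣ Fin.append p.1 p.2 i + γ := by
  intro h
  have h1 := isUnit_mk_append_add hp i
  rw [Ideal.Quotient.eq_zero_iff_mem.2 (Ideal.mem_span_singleton.2 h), isUnit_zero_iff] at h1
  rw [← map_one (Ideal.Quotient.mk (Ideal.span {ψ})), eq_comm, Ideal.Quotient.eq_zero_iff_mem,
    Ideal.mem_span_singleton] at h1
  exact hψ.not_isUnit (isUnit_of_dvd_one h1)

theorem dvd_eval_reciprocalNumerator (hp : p ∈ reciprocalSolutions k γ m ψ) :
    ψ ∣ (reciprocalNumerator (pairSign F[X] k) (Fin.append p.1 p.2)).eval γ := by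
  rw [← Ideal.mem_span_singleton, ← Ideal.Quotient.eq_zero_iff_mem, reciprocalNumerator,
    eval_finsetSum, map_sum]
  simp only [eval_mul, eval_C, eval_prod, eval_add, eval_X, map_mul, map_prod]
  have h1 := sum_mul_prod_erase_eq_zero
    (ε := fun i => Ideal.Quotient.mk (Ideal.span {ψ}) (pairSign F[X] k i))
    (isUnit_mk_append_add hp) (by
      rw [Fin.sum_univ_add]
      simp only [pairSign, Fin.append_left, Fin.append_right, map_one, map_neg, one_mul]
      rw [hp.2.2, ← Finset.mul_sum]
      ring)
  simpa only [add_comm γ] using h1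

end Solutions

section Solutions

theorem reciprocalCount_zero_le {F : Type*} [Field F] (k : ℕ) (γ ψ : F[X]) :
    reciprocalCount k γ 0 ψ ≤ 1 := by
  have h : reciprocalSolutions k γ 0 ψ ⊆ {0} := by
    rintro ⟨x, y⟩ ⟨h, -⟩
    have h0 : ∀ a : F[X], a.degree < (0 : ℕ) → a = 0 := fun a ha => by
      by_contra hne
      rw [Nat.cast_zero, ← not_le, zero_le_degree_iff] at ha
      exact ha hne
    exact Prod.ext (funext fun i => h0 _ (h i).1) (funext fun i => h0 _ (h i).2)
  exact (Set.ncard_le_ncard h).trans (Set.ncard_singleton _).le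

theorem reciprocalCount_le_card {F : Type*} [Field F] {k m : ℕ} {γ ψ : F[X]} {A : Finset F[X]}
    {s : Finset (Fin (k + k) → A)}
    (hs : ∀ p ∈ reciprocalSolutions k γ m ψ, ∃ x ∈ s, ∀ i, (x i : F[X]) = Fin.append p.1 p.2 i) :
    reciprocalCount k γ m ψ ≤ s.card := by
  classical
  let g : (Fin (k + k) → A) → (Fin k → F[X]) × (Fin k → F[X]) := fun x =>
    (fun i => x (Fin.castAdd k i), fun i => x (Fin.natAdd k i))
  have hsub : reciprocalSolutions k γ m ψ ⊆ s.image g := by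
    intro p hp
    obtain ⟨x, hx, hxp⟩ := hs p hp
    rw [Finset.mem_coe]
    refine Finset.mem_image.2 ⟨x, hx, Prod.ext (funext fun i => ?_) (funext fun i => ?_)⟩
    · exact (hxp _).trans (Fin.append_left _ _ _)
    · exact (hxp _).trans (Fin.append_right _ _ _)
  refine (Set.ncard_le_ncard hsub (Finset.finite_toSet _)).trans ?_
  rw [Set.ncard_coe_finset]
  exact Finset.card_image_le

theorem reciprocalCount_le {F : Type*} [Field F] [Finite F] [NormalizedGCDMonoid F[X]] {k m : ℕ}
    (hk : 1 ≤ k) {ψ γ : F[X]} (hψ : Irreducible ψ)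
    (hdeg : (k + k - 1) * (k + k - 1) * m < ψ.natDegree) {τ : ℝ} (hτ : 1 ≤ τ)
    (hdiv : ∀ G : F[X], G ≠ 0 → G.natDegree ≤ (k + k) * m →
      ∃ S : Finset F[X], (∀ z, gcd G z ∈ S) ∧ (S.card : ℝ) ≤ τ) :
    (reciprocalCount k γ m ψ : ℝ) ≤ 2 * (Nat.card F : ℝ) ^ (k * (m + 2)) *
      ((m + 1) * τ ^ (k + k) * (k + k : ℕ)) ^ (k + k) := by
  have : DecidableEq F[X] := Classical.decEq _
  obtain ⟨f, hf, hf0, hfA, hfw, hfroot, hfP⟩ :=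
    exists_common_primitive_factor (γ := γ) (by lia) hψ hdeg
  set A : Finset F[X] := (smallPolys F m).filter fun a => f.eval (-a) ≠ 0 with hA
  have hAm : ∀ a ∈ A, a.degree < m := fun a ha => mem_smallPolys.1 (Finset.mem_filter.1 ha).1
  set s : Finset (Fin (k + k) → A) := (Set.toFinite
    {x | f ∣ reciprocalNumerator (pairSign F[X] k) fun i => (x i : F[X])}).toFinset with hs
  have h1 : reciprocalCount k γ m ψ ≤ s.card := by
    refine reciprocalCount_le_card fun p hp => ?_
    refine ⟨fun i => ⟨Fin.append p.1 p.2 i, Finset.mem_filter.2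
      ⟨mem_smallPolys.2 (degree_append_lt hp i), hfroot _ (degree_append_lt hp i)
        (not_dvd_append_add hψ hp i)⟩⟩, ?_, fun i => rfl⟩
    rw [hs, Set.Finite.mem_toFinset]
    exact hfP _ (natDegree_reciprocalNumerator_le _ _)
      (weightedDegree_reciprocalNumerator_le m (isUnit_pairSign _ k) fun i =>
        natDegree_le_of_degree_le (degree_append_lt hp i).le) (dvd_eval_reciprocalNumerator hp)
  have h2 := card_reciprocalNumerator_multiples_le hf hf0 hAm
    (fun a ha => (Finset.mem_filter.1 ha).2) hτ (fun y hy => hdiv _ (Finset.mem_filter.1 hy).2 (by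
      refine (natDegree_eval_le_weightedDegree m f ?_).trans
        (hfw.trans (Nat.mul_le_mul_right _ (Nat.sub_le _ _)))
      rw [natDegree_neg]
      exact natDegree_le_of_degree_le (hAm y hy).le)) (isUnit_pairSign F[X] k) s
    fun x hx => by rw [hs, Set.Finite.mem_toFinset] at hx; exact hx
  refine (Nat.cast_le.2 h1).trans (h2.trans ?_)
  have h3 : (f.natDegree : ℝ) ≤ (k + k : ℕ) := Nat.cast_le.2 (by lia)
  gcongr

end Solutions

/-! ### Choice of constants and of `δ` -/

section Asymptotics

theorem exists_reciprocalCount_le {k : ℕ} (hk : 1 ≤ k) {η : ℝ} (hη : 0 < η) :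
    ∃ C : ℝ, 1 ≤ C ∧ ∀ (F : Type*) [Field F] [Finite F] (m : ℕ) (ψ γ : F[X]), Irreducible ψ →
      (k + k - 1) * (k + k - 1) * m < ψ.natDegree →
      (reciprocalCount k γ m ψ : ℝ) ≤
        C * (Nat.card F : ℝ) ^ (2 * k) * (Nat.card F : ℝ) ^ ((k + η) * m) := by
  have hk0 : (0 : ℝ) < k := by exact_mod_cast hk
  -- Divisor bounds are applied in degree at most `2km` and cost the exponent `ηm / (8k²)`. The
  -- inner power `2k` makes this `ηm / (4k)`, as for `m + 1`; together they give `ηm / (2k)`, and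
  -- the outer power `2k` gives `ηm`.
  obtain ⟨A, hA1, hA⟩ := exists_add_one_le_mul_rpow (ε := η / (4 * k)) (by positivity)
  obtain ⟨K, hK1, hK⟩ := exists_card_divisors_le (ε := η / (16 * k ^ 3)) (by positivity)
  refine ⟨2 * (A * K ^ (k + k) * (k + k : ℕ)) ^ (k + k), ?_, fun F _ _ m ψ γ hψ hdeg => ?_⟩
  · have h1 : (1 : ℝ) ≤ (k + k : ℕ) := by exact_mod_cast (by lia : 1 ≤ k + k)
    have h2 : 1 ≤ A * K ^ (k + k) * (k + k : ℕ) :=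
      one_le_mul_of_one_le_of_one_le (one_le_mul_of_one_le_of_one_le hA1 (one_le_pow₀ hK1)) h1
    linarith [one_le_pow₀ (n := k + k) h2]
  have := Classical.arbitrary (NormalizedGCDMonoid F[X])
  have hq : (2 : ℝ) ≤ Nat.card F := by exact_mod_cast Finite.one_lt_card (α := F)
  set q : ℝ := (Nat.card F : ℝ) with hqdef
  have hq0 : 0 < q := by linarith
  have hq1 : 1 ≤ q := by linarith
  set E : ℝ := η / (8 * k ^ 2) * m with hE
  have hE0 : 0 ≤ E := by positivity
  have hcount := reciprocalCount_le (γ := γ) hk hψ hdeg (τ := K * q ^ E)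
    (one_le_mul_of_one_le_of_one_le hK1 (Real.one_le_rpow hq1 hE0)) fun G hG hGm => by
      obtain ⟨S, hS, hSc⟩ := hK F G hG
      refine ⟨S, hS, hSc.trans ?_⟩
      refine mul_le_mul_of_nonneg_left (Real.rpow_le_rpow_of_exponent_le hq1 ?_) (by linarith)
      have h1 : (G.natDegree : ℝ) ≤ (k + k) * m := by exact_mod_cast hGm
      calc η / (16 * k ^ 3) * (G.natDegree : ℝ) ≤ η / (16 * k ^ 3) * ((k + k) * m) := by gcongr
        _ = E := by rw [hE]; field_simp; ring
  have hm : (m : ℝ) + 1 ≤ A * q ^ (η / (4 * k) * m) :=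
    (hA m).trans (mul_le_mul_of_nonneg_left
      (Real.rpow_le_rpow (by norm_num) hq (by positivity)) (by linarith))
  refine hcount.trans ?_
  have hmain : ((m : ℝ) + 1) * (K * q ^ E) ^ (k + k) * (k + k : ℕ) ≤
      A * K ^ (k + k) * (k + k : ℕ) * q ^ (η / (2 * k) * m) := by
    have h1 : (q ^ E) ^ (k + k) = q ^ (η / (4 * k) * m) := by
      rw [← Real.rpow_natCast, ← Real.rpow_mul hq0.le]
      congr 1
      rw [hE]; push_cast; field_simp; ring
    have h2 : q ^ (η / (2 * k) * m) = q ^ (η / (4 * k) * m) * q ^ (η / (4 * k) * m) := by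
      rw [← Real.rpow_add hq0]
      congr 1
      field_simp; ring
    rw [mul_pow, h1, h2]
    calc ((m : ℝ) + 1) * (K ^ (k + k) * q ^ (η / (4 * k) * m)) * (k + k : ℕ)
        ≤ (A * q ^ (η / (4 * k) * m)) * (K ^ (k + k) * q ^ (η / (4 * k) * m)) * (k + k : ℕ) := by
          gcongr
      _ = _ := by ring
  calc 2 * q ^ (k * (m + 2)) * (((m : ℝ) + 1) * (K * q ^ E) ^ (k + k) * (k + k : ℕ)) ^ (k + k)
      ≤ 2 * q ^ (k * (m + 2)) *
          (A * K ^ (k + k) * (k + k : ℕ) * q ^ (η / (2 * k) * m)) ^ (k + k) := by gcongr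
    _ = 2 * (A * K ^ (k + k) * (k + k : ℕ)) ^ (k + k) * q ^ (2 * k) * q ^ ((k + η) * m) := by
        have h1 : (q ^ (η / (2 * k) * m)) ^ (k + k) = q ^ (η * m) := by
          rw [← Real.rpow_natCast, ← Real.rpow_mul hq0.le]
          congr 1
          push_cast; field_simp; ring
        have h2 : q ^ ((k + η) * m) = q ^ (k * m) * q ^ (η * m) := by
          rw [add_mul, Real.rpow_add hq0, ← Real.rpow_natCast q (k * m)]
          push_cast; rfl
        rw [mul_pow _ (q ^ (η / (2 * k) * m)), h1, h2, mul_add, pow_add]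
        ring

/-- If a property of `m` and `η` holds for `η + L(η) / m` with every `η > 0`, then it holds for a
function of `m` which tends to `0`. -/
theorem exists_tendsto_zero_of_forall_pos {P : ℕ → ℝ → Prop}
    (h : ∀ η : ℝ, 0 < η → ∃ L : ℝ, 0 ≤ L ∧ ∀ m : ℕ, P m (η + L / m)) :
    ∃ δ : ℕ → ℝ, Filter.Tendsto δ Filter.atTop (nhds 0) ∧ ∀ m, P m (δ m) := by
  choose L hL0 hL using fun j : ℕ => h (1 / ((j : ℝ) + 1)) Nat.one_div_pos_of_nat
  have hne : ∀ m : ℕ, (Finset.range (m + 1)).Nonempty := fun m => ⟨0, by simp⟩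
  -- A finite minimum is attained, so the property passes to it. Once `m ≥ j` it is at most the
  -- `j`-th term, which is small for `j` large and then `m` large.
  refine ⟨fun m => (Finset.range (m + 1)).inf' (hne m) fun j => 1 / ((j : ℝ) + 1) + L j / m,
    ?_, fun m => ?_⟩
  · rw [Metric.tendsto_atTop]
    intro ε hε
    obtain ⟨j, hj⟩ := exists_nat_one_div_lt (half_pos hε)
    obtain ⟨M, hM⟩ := exists_nat_gt (L j / (ε / 2))
    refine ⟨max j (M + 1), fun m hm => ?_⟩
    have hmj : j ∈ Finset.range (m + 1) := Finset.mem_range.2 (by lia)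
    have hm0 : (0 : ℝ) < m := by exact_mod_cast (by lia : 0 < m)
    have h1 := Finset.inf'_le (fun j : ℕ => 1 / ((j : ℝ) + 1) + L j / m) hmj
    have h2 : L j / m < ε / 2 := by
      rw [div_lt_iff₀ hm0]
      rw [div_lt_iff₀ (half_pos hε)] at hM
      have h3 : (M : ℝ) ≤ m := by exact_mod_cast (by lia : M ≤ m)
      nlinarith
    have h4 : 0 ≤ (Finset.range (m + 1)).inf' (hne m) fun j => 1 / ((j : ℝ) + 1) + L j / m := by
      rw [Finset.le_inf'_iff]
      intro i _
      have := hL0 i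
      positivity
    rw [Real.dist_eq, sub_zero, abs_of_nonneg h4]
    linarith
  · obtain ⟨j, -, hj⟩ := (Finset.range (m + 1)).exists_mem_eq_inf' (hne m)
      fun j => 1 / ((j : ℝ) + 1) + L j / m
    simp only [hj]
    exact hL j m

/-- The bound `q ^ ((k + η) m)` for the number of solutions, over all finite fields and for all
irreducible `ψ` of large degree. -/
def ReciprocalCountBound.{u} (k m : ℕ) (η : ℝ) : Prop :=
  ∀ (F : Type u) [Field F] [Finite F] (n : ℕ) (ψ γ : F[X]), Irreducible ψ → ψ.natDegree = n →
    (m : ℝ) < (n : ℝ) / (4 * (k : ℝ) ^ 2 - 2 * (k : ℝ)) →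
    (reciprocalCount k γ m ψ : ℝ) ≤ (Nat.card F : ℝ) ^ (((k : ℝ) + η) * (m : ℝ))

theorem exists_reciprocalCountBound {k : ℕ} (hk : 1 ≤ k) {η : ℝ} (hη : 0 < η) :
    ∃ L : ℝ, 0 ≤ L ∧ ∀ m : ℕ, ReciprocalCountBound k m (η + L / m) := by
  obtain ⟨C, hC1, hC⟩ := exists_reciprocalCount_le hk hη
  have hC0 : 0 < C := by linarith
  -- As `q ≥ 2`, `C ≤ q ^ logb 2 C`; so `C * q ^ (2k)` is absorbed by an exponent independent of
  -- `q`.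
  refine ⟨Real.logb 2 C + 2 * k, add_nonneg (Real.logb_nonneg (by norm_num) hC1) (by positivity),
    fun m F _ _ n ψ γ hψ hn hm => ?_⟩
  -- For `m = 0` the term `L / m` absorbs nothing, but only the zero tuple can be a solution.
  rcases Nat.eq_zero_or_pos m with rfl | hm0
  · simpa using reciprocalCount_zero_le k γ ψ
  have hk1 : (1 : ℝ) ≤ k := by exact_mod_cast hk
  -- The hypothesis suffices because `(2k - 1)² ≤ 2k(2k - 1) = 4k² - 2k`.
  have hdeg : (k + k - 1) * (k + k - 1) * m < ψ.natDegree := by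
    rw [hn, ← Nat.cast_lt (α := ℝ)]
    push_cast [Nat.cast_sub (by lia : 1 ≤ k + k)]
    rw [lt_div_iff₀ (by nlinarith)] at hm
    nlinarith [mul_nonneg (Nat.cast_nonneg (α := ℝ) m) (by linarith : (0 : ℝ) ≤ 2 * k - 1)]
  have hq : (2 : ℝ) ≤ Nat.card F := by exact_mod_cast Finite.one_lt_card (α := F)
  set q : ℝ := (Nat.card F : ℝ) with hqdef
  have hq0 : 0 < q := by linarith
  have hm0' : (m : ℝ) ≠ 0 := by positivity
  have hCq : C ≤ q ^ Real.logb 2 C := by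
    conv_lhs => rw [← Real.rpow_logb (b := 2) (by norm_num) (by norm_num) hC0]
    exact Real.rpow_le_rpow (by norm_num) hq (Real.logb_nonneg (by norm_num) hC1)
  calc (reciprocalCount k γ m ψ : ℝ) ≤ C * q ^ (2 * k) * q ^ ((k + η) * m) := hC F m ψ γ hψ hdeg
    _ ≤ q ^ Real.logb 2 C * q ^ (2 * k) * q ^ ((k + η) * m) := by gcongr
    _ = q ^ ((k + (η + (Real.logb 2 C + 2 * k) / m)) * m) := by
        rw [← Real.rpow_natCast, ← Real.rpow_add hq0, ← Real.rpow_add hq0]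
        congr 1
        push_cast
        field_simp
        ring

end Asymptotics

/-- The `o(1)` term is a function `δ` of `m` which tends to `0` and depends only on `k`: it serves
all finite fields `F` (with `q = Nat.card F`), all `n`, all `ψ` and all `γ`. -/
theorem theorem1p1 (k : ℕ) (hk : 1 ≤ k) :
    ∃ δ : ℕ → ℝ, Filter.Tendsto δ Filter.atTop (nhds 0) ∧
      ∀ (F : Type*) [Field F] [Finite F] (n m : ℕ) (ψ γ : Polynomial F),
        ψ.Monic → Irreducible ψ → ψ.natDegree = n →
        (m : ℝ) < (n : ℝ) / (4 * (k : ℝ) ^ 2 - 2 * (k : ℝ)) →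
        (reciprocalCount k γ m ψ : ℝ) ≤ (Nat.card F : ℝ) ^ (((k : ℝ) + δ m) * (m : ℝ)) := by
  obtain ⟨δ, hδ, hP⟩ := exists_tendsto_zero_of_forall_pos (P := ReciprocalCountBound k)
    fun η hη => exists_reciprocalCountBound hk hη
  exact ⟨δ, hδ, fun F _ _ n m ψ γ _ => hP m F n ψ γ⟩
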